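/- Let $H_{\mathbb R}$ be a separable real Hilbert space and $H=H_{\mathbb R}\oplus iH_{\mathbb R}$ its complexification, with inner product $\langle\cdot,\cdot\rangle$ antilinear on the left and linear on the right. Let $q,t\in\mathbb R$ with $0<t<1$ and $|q|\le t$. On the algebraic full Fock space $\mathcal F_{\rm fin}(H)=\bigoplus_{n\ge 0}H^{\otimes n}$, $H^{\otimes 0}=\mathbb C\Omega$, let $$\langle x_1\otimes\cdots\otimes x_m,\,y_1\otimes\cdots\otimes y_n\rangle_{q,t}=\langle x_1\otimes\cdots\otimes x_m,\,\tilde P^{(n)}_{q,t}(y_1\otimes\cdots\otimes y_n)\rangle_{0,0},\qquad \tilde P^{(n)}_{q,t}=t^{\binom n2}\sum_{\sigma\in S(n)}(q/t)^{|\sigma|}\,\sigma,$$ where $\langle x_1\otimes\cdots\otimes x_m,y_1\otimes\cdots\otimes y_n\rangle_{0,0}=\delta_{m,n}\prod_{i=1}^n\langle x_i,y_i\rangle$, the permutation $\sigma$ acts by permuting the tensor factors, and $|\sigma|$ is its number of inversions. For $x\in H$ and a bounded self-adjoint operator $T$ on $H$ define linear operators on $\mathcal F_{\rm fin}(H)$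 by $a_{q,t}(x)\Omega=0$, $a^*_{q,t}(x)\Omega=x$, $\tilde p(T)\Omega=0$ and, for $n\ge 1$ (where $\check x_k$ means that $x_k$ is omitted and $0^0=1$), $$a_{q,t}(x)(x_1\otimes\cdots\otimes x_n)=\sum_{k=1}^n t^{k-1}q^{n-k}\langle x,x_k\rangle\,x_1\otimes\cdots\otimes\check x_k\otimes\cdots\otimes x_n,$$ $$a^*_{q,t}(x)(x_1\otimes\cdots\otimes x_n)=x_1\otimes\cdots\otimes x_n\otimes x,$$ $$\tilde p(T)(x_1\otimes\cdots\otimes x_n)=\sum_{k=1}^n t^{k-1}q^{n-k}\,x_1\otimes\cdots\otimes\check x_k\otimes\cdots\otimes x_n\otimes T(x_k).$$ For each $x\in H_{\mathbb R}$ let $T_x$ be a bounded self-adjoint operator on $H$, put $Y_{q,t}(x)=a_{q,t}(x)+a^*_{q,t}(x)+\tilde p(T_x)$, and let $\tilde\varphi(X)=\langle\Omega,X\Omega\rangle_{q,t}$. Then for all $n\ge 0$ and $x_1,\dots,x_n\in H_{\mathbb R}$, $$\tilde\varphi\big(Y_{q,t}(x_n)\cdots Y_{q,t}(x_1)\big)=\sum_{\pi\in\mathcal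 P_{\ge2}(n)}q^{\mathrm{rc}(\pi)}\,t^{\mathrm{rarc}(\pi)}\prod_{\substack{B\in\pi\\ B=\{i_1<\cdots<i_m\}}}\big\langle x_{i_m},\,T_{x_{i_{m-1}}}\cdots T_{x_{i_2}}x_{i_1}\big\rangle .$$ Here $\mathcal P_{\ge2}(n)$ is the set of partitions of $\{1,\dots,n\}$ without singleton blocks, an arc of $\pi$ is a pair $(i,j)$, $i<j$, of consecutive elements of a block of $\pi$, $\mathrm{rc}(\pi)$ is the number of pairs of arcs $(i,j),(i',j')$ with $i<i'<j<j'$, and $\mathrm{rarc}(\pi)$ is the number of pairs of arcs $(i,j),(i',j')$ with $i<i'<j'<j$. -/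

import Mathlib

open scoped TensorProduct DirectSum

/-- The complexification `H = E ⊕ iE` of a real vector space `E`;
the element `⟨a, b⟩` stands for `a + i b`. -/
@[ext]
structure Complexification (E : Type*) where
  re : E
  im : E

namespace Complexification

noncomputable section

section Algebra

variable {E : Type*} [AddCommGroup E]

instance : Zero (Complexification E) := ⟨⟨0, 0⟩⟩
instance : Add (Complexification E) := ⟨fun z w => ⟨z.re + w.re, z.im + w.im⟩⟩
instance : Neg (Complexification E) := ⟨fun z => ⟨-z.re, -z.im⟩⟩

@[simp] theorem zero_re : (0 : Complexification E).re = 0 := rfl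
@[simp] theorem zero_im : (0 : Complexification E).im = 0 := rfl
@[simp] theorem add_re (z w : Complexification E) : (z + w).re = z.re + w.re := rfl
@[simp] theorem add_im (z w : Complexification E) : (z + w).im = z.im + w.im := rfl
@[simp] theorem neg_re (z : Complexification E) : (-z).re = -z.re := rfl
@[simp] theorem neg_im (z : Complexification E) : (-z).im = -z.im := rfl

instance : AddCommGroup (Complexification E) where
  add_assoc a b c := by ext <;> simp [add_assoc]
  zero_add a := by ext <;> simp
  add_zero a := by ext <;> simp
  add_comm a b := by ext <;> simp [add_comm]
  neg_add_cancel a := by ext <;> simp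
  nsmul := nsmulRec
  zsmul := zsmulRec

@[simp] theorem sub_re (z w : Complexification E) : (z - w).re = z.re - w.re := by
  simp [sub_eq_add_neg]
@[simp] theorem sub_im (z w : Complexification E) : (z - w).im = z.im - w.im := by
  simp [sub_eq_add_neg]

variable [Module ℝ E]

/-- `(c + i d) (a + i b) = (c a - d b) + i (c b + d a)`. -/
instance : SMul ℂ (Complexification E) :=
  ⟨fun c z => ⟨c.re • z.re - c.im • z.im, c.re • z.im + c.im • z.re⟩⟩

@[simp] theorem smul_re (c : ℂ) (z : Complexification E) :
    (c • z).re = c.re • z.re - c.im • z.im := rfl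
@[simp] theorem smul_im (c : ℂ) (z : Complexification E) :
    (c • z).im = c.re • z.im + c.im • z.re := rfl

instance : Module ℂ (Complexification E) where
  one_smul a := by ext <;> simp
  mul_smul a b x := by
    ext <;> simp only [smul_re, smul_im, Complex.mul_re, Complex.mul_im] <;> module
  smul_zero a := by ext <;> simp
  smul_add a x y := by ext <;> simp <;> module
  add_smul a b x := by ext <;> simp <;> module
  zero_smul x := by ext <;> simp

end Algebra

section Analysis

variable {E : Type*} [NormedAddCommGroup E] [InnerProductSpace ℝ E]

/-- The Hermitian inner product, antilinear on the left and linear on the right: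
`⟨a + i b, c + i d⟩ = ⟨a, c⟩ + ⟨b, d⟩ + i (⟨a, d⟩ - ⟨b, c⟩)`. -/
@[reducible]
def innerCore : InnerProductSpace.Core ℂ (Complexification E) where
  inner z w := ⟨inner ℝ z.re w.re + inner ℝ z.im w.im, inner ℝ z.re w.im - inner ℝ z.im w.re⟩
  conj_inner_symm z w := by
    apply Complex.ext <;> simp [real_inner_comm]
  re_inner_nonneg z := by
    simpa using add_nonneg (real_inner_self_nonneg (x := z.re)) (real_inner_self_nonneg (x := z.im))
  add_left x y z := by
    apply Complex.ext <;> simp [inner_add_left] <;> ring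
  smul_left x y r := by
    apply Complex.ext <;>
      simp [inner_add_left, inner_sub_left, real_inner_smul_left] <;> ring
  definite z h := by
    have h1 := congrArg Complex.re h
    simp only [Complex.zero_re] at h1
    have ha := real_inner_self_nonneg (x := z.re)
    have hb := real_inner_self_nonneg (x := z.im)
    ext
    · exact inner_self_eq_zero.1 (le_antisymm (by linarith) ha : inner ℝ z.re z.re = 0)
    · exact inner_self_eq_zero.1 (le_antisymm (by linarith) hb : inner ℝ z.im z.im = 0)

instance : NormedAddCommGroup (Complexification E) :=
  innerCore.toNormedAddCommGroup

instance : InnerProductSpace ℂ (Complexification E) :=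
  InnerProductSpace.ofCore innerCore.toCore

theorem inner_def (z w : Complexification E) :
    inner ℂ z w =
      ⟨inner ℝ z.re w.re + inner ℝ z.im w.im, inner ℝ z.re w.im - inner ℝ z.im w.re⟩ := rfl

theorem norm_sq_eq (z : Complexification E) : ‖z‖ ^ 2 = ‖z.re‖ ^ 2 + ‖z.im‖ ^ 2 := by
  rw [InnerProductSpace.norm_sq_eq_re_inner (𝕜 := ℂ) z, inner_def]
  simp

/-- The complexification of a Hilbert space is complete. -/
instance [CompleteSpace E] : CompleteSpace (Complexification E) := by
  let e : Complexification E ≃ WithLp 2 (E × E) :=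
    { toFun := fun z => WithLp.toLp 2 (z.re, z.im)
      invFun := fun p => ⟨p.fst, p.snd⟩
      left_inv := fun _ => rfl
      right_inv := fun _ => rfl }
  have he : Isometry e := Isometry.of_dist_eq fun z w => by
    rw [dist_eq_norm, dist_eq_norm]
    refine (sq_eq_sq₀ (norm_nonneg _) (norm_nonneg _)).1 ?_
    rw [WithLp.prod_norm_sq_eq_of_L2, norm_sq_eq, sub_re, sub_im]
    rfl
  exact (IsometryEquiv.completeSpace_iff ⟨e, he⟩).2 inferInstance

/-- The inclusion of the real space `E` into its complexification. -/
def ofReal (x : E) : Complexification E := ⟨x, 0⟩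

end Analysis

end

end Complexification

namespace QTFock

noncomputable section

/-- The algebraic full Fock space `⨁ₙ H^{⊗ n}` (no completion). -/
abbrev Fock (H : Type*) [AddCommGroup H] [Module ℂ H] : Type _ :=
  ⨁ n : ℕ, ⨂[ℂ]^n H

section Operators

variable {H : Type*} [NormedAddCommGroup H] [InnerProductSpace ℂ H]

variable (H) in
/-- The vacuum vector `Ω ∈ H^{⊗ 0}`. -/
def vacuum : Fock H := DirectSum.lof ℂ ℕ (fun n => ⨂[ℂ]^n H) 0 (PiTensorProduct.tprod ℂ Fin.elim0)

/-- The number of inversions of a permutation. -/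
def inversions {n : ℕ} (σ : Equiv.Perm (Fin n)) : ℕ :=
  (Finset.univ.filter fun p : Fin n × Fin n => p.1 < p.2 ∧ σ p.2 < σ p.1).card

variable (H) in
/-- The `(q,t)`-symmetrization `t^{n choose 2} ∑_{σ ∈ S(n)} (q/t)^{|σ|} σ` on `H^{⊗ n}`. -/
def symmetrization (q t : ℝ) (n : ℕ) : ⨂[ℂ]^n H →ₗ[ℂ] ⨂[ℂ]^n H :=
  ((t : ℂ) ^ n.choose 2) • ∑ σ : Equiv.Perm (Fin n),
    (((q / t : ℝ) : ℂ) ^ inversions σ) •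
      (PiTensorProduct.reindex ℂ (fun _ : Fin n => H) σ).toLinearMap

/-- The linear functional `x₁ ⊗ ⋯ ⊗ xₙ ↦ ∏ᵢ ⟨yᵢ, xᵢ⟩` on `H^{⊗ n}`. -/
def innerLeft {n : ℕ} (y : Fin n → H) : ⨂[ℂ]^n H →ₗ[ℂ] ℂ :=
  PiTensorProduct.lift
    ((MultilinearMap.mkPiAlgebra ℂ (Fin n) ℂ).compLinearMap fun i => (innerₛₗ ℂ (y i)))

theorem innerLeft_tprod {n : ℕ} (y x : Fin n → H) :
    innerLeft y (PiTensorProduct.tprod ℂ x) = ∏ i, inner ℂ (y i) (x i) := by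
  simp [innerLeft]

theorem innerLeft_star_tprod {n : ℕ} (y x : Fin n → H) :
    star (innerLeft y (PiTensorProduct.tprod ℂ x)) = innerLeft x (PiTensorProduct.tprod ℂ y) := by
  simp [innerLeft_tprod]

theorem innerLeft_update_add {n : ℕ} (y : Fin n → H) (i : Fin n) (a b : H) :
    innerLeft (Function.update y i (a + b)) =
      innerLeft (Function.update y i a) + innerLeft (Function.update y i b) := by
  refine PiTensorProduct.ext (MultilinearMap.ext fun x => star_injective ?_)
  simp only [LinearMap.compMultilinearMap_apply, LinearMap.add_apply, star_add,
    innerLeft_star_tprod, MultilinearMap.map_update_add, map_add]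

theorem innerLeft_update_smul {n : ℕ} (y : Fin n → H) (i : Fin n) (c : ℂ) (a : H) :
    innerLeft (Function.update y i (c • a)) = star c • innerLeft (Function.update y i a) := by
  refine PiTensorProduct.ext (MultilinearMap.ext fun x => star_injective ?_)
  simp only [LinearMap.compMultilinearMap_apply, LinearMap.smul_apply, star_smul, star_star,
    innerLeft_star_tprod, MultilinearMap.map_update_smul, map_smul]

/-- The undeformed inner product of `H^{⊗ n}`, with the second (linear) argument first:
`tensorInner n g f = ⟨f, g⟩_{0,0}`. -/
def tensorInner (n : ℕ) : ⨂[ℂ]^n H →ₗ[ℂ] ⨂[ℂ]^n H →ₗ⋆[ℂ] ℂ :=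
  PiTensorProduct.lift
    { toFun := fun y => (starLinearEquiv ℂ (A := ℂ)).toLinearMap.comp (innerLeft y)
      map_update_add' := by
        intro inst y i a b
        obtain rfl : inst = instDecidableEqFin n := Subsingleton.elim _ _
        rw [innerLeft_update_add, LinearMap.comp_add]
      map_update_smul' := by
        intro inst y i c a
        obtain rfl : inst = instDecidableEqFin n := Subsingleton.elim _ _
        rw [innerLeft_update_smul]
        ext x
        simp }

theorem tensorInner_tprod {n : ℕ} (y x : Fin n → H) :
    tensorInner n (PiTensorProduct.tprod ℂ y) (PiTensorProduct.tprod ℂ x)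
      = ∏ i, inner ℂ (x i) (y i) := by
  simp [tensorInner, innerLeft]

variable (H) in
/-- The `(q,t)`-deformed inner product of the Fock space, with the second (linear) argument first:
`fockInner q t g f = ∑ₙ ⟨fₙ, P̃ₙ gₙ⟩_{0,0}`. -/
def fockInner (q t : ℝ) : Fock H →ₗ[ℂ] Fock H →ₗ⋆[ℂ] ℂ :=
  DirectSum.toModule ℂ ℕ (Fock H →ₗ⋆[ℂ] ℂ) fun n =>
    { toFun := fun g => (tensorInner n (symmetrization H q t n g)).comp
        (DirectSum.component ℂ ℕ (fun n => ⨂[ℂ]^n H) n)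
      map_add' := fun g h => by ext; simp
      map_smul' := fun c g => by ext; simp }

/-- The vacuum state `X ↦ ⟨Ω, X Ω⟩` of the `(q,t)`-Fock space. -/
def vacuumState (q t : ℝ) (X : Module.End ℂ (Fock H)) : ℂ :=
  fockInner H q t (X (vacuum H)) (vacuum H)

/-- `x₁ ⊗ ⋯ ⊗ xₙ ↦ x₁ ⊗ ⋯ ⊗ xₙ ⊗ y`, linear in `y`. -/
def appendLinear (n : ℕ) : H →ₗ[ℂ] MultilinearMap ℂ (fun _ : Fin n => H) (⨂[ℂ]^(n + 1) H) :=
  (PiTensorProduct.tprod ℂ (s := fun _ : Fin (n + 1) => H)).curryMid (Fin.last n)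

theorem appendLinear_apply (n : ℕ) (y : H) (f : Fin n → H) :
    appendLinear n y f = PiTensorProduct.tprod ℂ (Fin.snoc f y : Fin (n + 1) → H) := by
  simp [appendLinear, Fin.insertNth_last']

/-- The creation operator `x₁ ⊗ ⋯ ⊗ xₙ ↦ x₁ ⊗ ⋯ ⊗ xₙ ⊗ x`, `Ω ↦ x`. -/
def creation (x : H) : Module.End ℂ (Fock H) :=
  DirectSum.toModule ℂ ℕ (Fock H) fun n =>
    DirectSum.lof ℂ ℕ (fun n => ⨂[ℂ]^n H) (n + 1) ∘ₗ PiTensorProduct.lift (appendLinear n x)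

/-- The restriction to `H^{⊗ (m+1)}` of the annihilation operator. With positions counted from `0`:
`x₀ ⊗ ⋯ ⊗ x_m ↦ ∑ₖ t^k q^{m-k} ⟨x, xₖ⟩ x₀ ⊗ ⋯ ⊗ x̌ₖ ⊗ ⋯ ⊗ x_m`. -/
def annihilationAux (q t : ℝ) (x : H) (m : ℕ) : ⨂[ℂ]^(m + 1) H →ₗ[ℂ] ⨂[ℂ]^m H :=
  PiTensorProduct.lift (∑ k : Fin (m + 1), ((t : ℂ) ^ (k : ℕ) * (q : ℂ) ^ (m - (k : ℕ))) •
    LinearMap.uncurryMid (M := fun _ : Fin (m + 1) => H) k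
      ((innerₛₗ ℂ x).smulRight (PiTensorProduct.tprod ℂ (s := fun _ : Fin m => H))))

theorem annihilationAux_tprod (q t : ℝ) (x : H) (m : ℕ) (f : Fin (m + 1) → H) :
    annihilationAux q t x m (PiTensorProduct.tprod ℂ f) =
      ∑ k : Fin (m + 1), ((t : ℂ) ^ (k : ℕ) * (q : ℂ) ^ (m - (k : ℕ)) * inner ℂ x (f k)) •
        PiTensorProduct.tprod ℂ (k.removeNth f : Fin m → H) := by
  simp [annihilationAux, mul_smul]

/-- The `(q,t)`-annihilation operator, which sends `Ω` to `0`. -/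
def annihilation (q t : ℝ) (x : H) : Module.End ℂ (Fock H) :=
  DirectSum.toModule ℂ ℕ (Fock H) fun n =>
    match n with
    | 0 => 0
    | m + 1 => DirectSum.lof ℂ ℕ (fun n => ⨂[ℂ]^n H) m ∘ₗ annihilationAux q t x m

/-- The restriction to `H^{⊗ (m+1)}` of the gauge operator. With positions counted from `0`:
`x₀ ⊗ ⋯ ⊗ x_m ↦ ∑ₖ t^k q^{m-k} x₀ ⊗ ⋯ ⊗ x̌ₖ ⊗ ⋯ ⊗ x_m ⊗ T xₖ`. -/
def gaugeAux (q t : ℝ) (T : H →L[ℂ] H) (m : ℕ) : ⨂[ℂ]^(m + 1) H →ₗ[ℂ] ⨂[ℂ]^(m + 1) H :=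
  PiTensorProduct.lift (∑ k : Fin (m + 1), ((t : ℂ) ^ (k : ℕ) * (q : ℂ) ^ (m - (k : ℕ))) •
    LinearMap.uncurryMid (M := fun _ : Fin (m + 1) => H) k (appendLinear m ∘ₗ T.toLinearMap))

theorem gaugeAux_tprod (q t : ℝ) (T : H →L[ℂ] H) (m : ℕ) (f : Fin (m + 1) → H) :
    gaugeAux q t T m (PiTensorProduct.tprod ℂ f) =
      ∑ k : Fin (m + 1), ((t : ℂ) ^ (k : ℕ) * (q : ℂ) ^ (m - (k : ℕ))) •
        PiTensorProduct.tprod ℂ (Fin.snoc (k.removeNth f) (T (f k)) : Fin (m + 1) → H) := by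
  simp [gaugeAux, appendLinear_apply]

/-- The `(q,t)`-gauge operator, which sends `Ω` to `0`. -/
def gaugeOperator (q t : ℝ) (T : H →L[ℂ] H) : Module.End ℂ (Fock H) :=
  DirectSum.toModule ℂ ℕ (Fock H) fun n =>
    match n with
    | 0 => 0
    | m + 1 => DirectSum.lof ℂ ℕ (fun n => ⨂[ℂ]^n H) (m + 1) ∘ₗ gaugeAux q t T m

/-- `Y(x) = a(x) + a*(x) + p̃(T)`, with `T = T_x` the operator attached to `x`. -/
def fieldOperator (q t : ℝ) (x : H) (T : H →L[ℂ] H) : Module.End ℂ (Fock H) :=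
  annihilation q t x + creation x + gaugeOperator q t T

end Operators

section Partitions

variable {n : ℕ}

/-- The arcs of a block: the pairs of consecutive elements of the block. -/
def blockArcs (B : Finset (Fin n)) : Finset (Fin n × Fin n) :=
  (B ×ˢ B).filter fun p => p.1 < p.2 ∧ ∀ k ∈ B, ¬(p.1 < k ∧ k < p.2)

/-- The arcs of a set partition: the arcs of its blocks. -/
def arcs (π : Finpartition (Finset.univ : Finset (Fin n))) : Finset (Fin n × Fin n) :=
  π.parts.biUnion blockArcs

/-- The number of restricted crossings: of pairs of arcs `(i, j)`, `(i', j')` with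
`i < i' < j < j'`. -/
def rc (π : Finpartition (Finset.univ : Finset (Fin n))) : ℕ :=
  ((arcs π ×ˢ arcs π).filter fun p =>
    p.1.1 < p.2.1 ∧ p.2.1 < p.1.2 ∧ p.1.2 < p.2.2).card

/-- The number of restricted nestings: of pairs of arcs `(i, j)`, `(i', j')` with
`i < i' < j' < j`. -/
def rarc (π : Finpartition (Finset.univ : Finset (Fin n))) : ℕ :=
  ((arcs π ×ˢ arcs π).filter fun p =>
    p.1.1 < p.2.1 ∧ p.2.2 < p.1.2).card

/-- The factor `⟨x_{i_m}, T_{i_{m-1}} ⋯ T_{i_2} x_{i_1}⟩` of a block `B = {i_1 < ⋯ < i_m}`. -/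
def blockFactor {H : Type*} [NormedAddCommGroup H] [InnerProductSpace ℂ H]
    (x : Fin n → H) (T : Fin n → H →L[ℂ] H) (B : Finset (Fin n)) (hB : B.Nonempty) : ℂ :=
  inner ℂ (x (B.max' hB))
    (((((B.erase (B.min' hB)).erase (B.max' hB)).sort (· ≤ ·)).map T).reverse.prod
      (x (B.min' hB)))

end Partitions

end

end QTFock

/-! Apply the operators one at a time to `Ω` and keep track of where each tensor factor came from.
At any moment the vector is a combination of elementary tensors whose factors carry labels `s 0 < s
1 < ⋯`: a factor labelled `i` stands for a block still under construction whose latest point is `i`.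
The next operator, with index `j`, can do three things. Creation opens a new block at `j`.
Annihilation of the factor labelled `k` closes a block by the arc `(k, j)`. The gauge operator
continues that block by the arc `(k, j)`, replaces its vector `v` by `T_j v`, and moves it to the
last position with label `j`. Labels therefore stay increasing, and position in the tensor is order
of labels.

Every other open block must later receive an arc that ends after `j`. Such an arc crosses `(k, j)`
if it starts after `k`, and encloses it if it starts before `k`. The numbers of factors to the right
and to the left of `k` are exactly the exponents of `q` and `t` in the operators, so each arc is
charged for its crossings and nestings when it is drawn.

To run this as an induction the claim is generalised to an arbitrary starting tensor with labels `L`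
(`vacuumFunctional_prod_fieldOperator`): the expectation is a sum over partitions of `L` together
with the remaining indices, without singletons, in which points of `L` lie in distinct blocks.
`sum_admissible` is the matching recursion for partitions; it rests on `weight_insert_pair` and
`weight_image_attach`, the effect on the weight of closing and of continuing a block. Finally only
the degree-zero component survives against `Ω`. -/

namespace QTFock

noncomputable section

/-! ### Crossings and nestings gained by adding one arc -/

section Arcs

variable {N : ℕ}

/-- The arcs of a family of blocks. -/
def familyArcs (P : Finset (Finset (Fin N))) : Finset (Fin N × Fin N) :=
  P.biUnion blockArcs

/-- The number of crossing pairs in a set of arcs. -/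
def crossings (A : Finset (Fin N × Fin N)) : ℕ :=
  ((A ×ˢ A).filter fun p => p.1.1 < p.2.1 ∧ p.2.1 < p.1.2 ∧ p.1.2 < p.2.2).card

/-- The number of nested pairs in a set of arcs. -/
def nestings (A : Finset (Fin N × Fin N)) : ℕ :=
  ((A ×ˢ A).filter fun p => p.1.1 < p.2.1 ∧ p.2.2 < p.1.2).card

theorem mem_blockArcs {B : Finset (Fin N)} {p : Fin N × Fin N} :
    p ∈ blockArcs B ↔
      p.1 ∈ B ∧ p.2 ∈ B ∧ p.1 < p.2 ∧ ∀ k ∈ B, ¬(p.1 < k ∧ k < p.2) := by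
  simp [blockArcs, and_assoc]

theorem mem_familyArcs {P : Finset (Finset (Fin N))} {p : Fin N × Fin N} :
    p ∈ familyArcs P ↔ ∃ B ∈ P, p ∈ blockArcs B := by
  simp [familyArcs]

/-- An arc `(k, j)` such that the arcs starting before `j` are exactly those issued from the
points of `L`, and all end after `j`, is crossed by the arcs issued from the points of `L`
after `k`. -/
theorem crossings_insert {A : Finset (Fin N × Fin N)} {L : Finset (Fin N)} {k j : Fin N}
    (hA : ∀ b ∈ A, b.1 < j → b.1 ∈ L ∧ j < b.2)
    (hL : ∀ i ∈ L, i < j ∧ ∃ b ∈ A, b.1 = i) (hinj : ∀ b ∈ A, ∀ c ∈ A, b.1 = c.1 → b = c)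
    (hkL : k ∉ L) (hkj : k < j) :
    crossings (insert (k, j) A) = crossings A + (L.filter (k < ·)).card := by
  have hkA : (k, j) ∉ A := fun h => hkL (hA _ h hkj).1
  -- Taking starting points is a bijection from the relevant arcs onto the relevant points of `L`.
  have hcard : (L.filter (k < ·)).card = (A.filter fun b => k < b.1 ∧ b.1 < j).card := by
    symm
    refine Finset.card_bij (fun b _ => b.1) ?_ ?_ ?_
    · intro b hb
      simp only [Finset.mem_filter] at hb ⊢
      exact ⟨(hA b hb.1 hb.2.2).1, hb.2.1⟩
    · intro b hb c hc h
      exact hinj b (Finset.mem_filter.1 hb).1 c (Finset.mem_filter.1 hc).1 h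
    · intro i hi
      rw [Finset.mem_filter] at hi
      obtain ⟨hij, b, hb, rfl⟩ := hL i hi.1
      exact ⟨b, Finset.mem_filter.2 ⟨hb, hi.2, hij⟩, rfl⟩
  have hset : ((insert (k, j) A ×ˢ insert (k, j) A).filter fun p =>
        p.1.1 < p.2.1 ∧ p.2.1 < p.1.2 ∧ p.1.2 < p.2.2) =
      ((A ×ˢ A).filter fun p => p.1.1 < p.2.1 ∧ p.2.1 < p.1.2 ∧ p.1.2 < p.2.2) ∪
        (A.filter fun b => k < b.1 ∧ b.1 < j).map ⟨fun b => ((k, j), b), fun a b h => by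
          simpa using h⟩ := by
    ext ⟨a, b⟩
    simp only [Finset.mem_filter, Finset.mem_product, Finset.mem_insert, Finset.mem_union,
      Finset.mem_map]
    constructor
    · rintro ⟨⟨ha | ha, hb | hb⟩, h1, h2, h3⟩
      · subst ha hb; exact absurd h1 (lt_irrefl _)
      · subst ha; exact Or.inr ⟨b, ⟨hb, h1, h2⟩, rfl⟩
      -- The new arc is never the right-hand one in a crossing: an older arc starting before `k`
      -- would have to end before `j`.
      · subst hb
        exact absurd h3 (not_lt.2 (hA a ha (h1.trans hkj)).2.le)
      · exact Or.inl ⟨⟨ha, hb⟩, h1, h2, h3⟩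
    · rintro (⟨⟨ha, hb⟩, h⟩ | ⟨c, ⟨hc, h1, h2⟩, h⟩)
      · exact ⟨⟨Or.inr ha, Or.inr hb⟩, h⟩
      · obtain ⟨rfl, rfl⟩ := Prod.mk.inj h
        exact ⟨⟨Or.inl rfl, Or.inr hc⟩, h1, h2, (hA c hc h2).2⟩
  rw [crossings, hset, Finset.card_union_of_disjoint, Finset.card_map, ← hcard, crossings]
  rw [Finset.disjoint_left]
  rintro ⟨a, b⟩ h h'
  simp only [Finset.mem_filter, Finset.mem_product, Finset.mem_map] at h h'
  obtain ⟨c, -, h'⟩ := h'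
  obtain ⟨rfl, rfl⟩ := Prod.mk.inj h'
  exact hkA h.1.1

/-- In the situation of `crossings_insert`, the arc `(k, j)` is nested in the arcs issued from the
points of `L` before `k`. -/
theorem nestings_insert {A : Finset (Fin N × Fin N)} {L : Finset (Fin N)} {k j : Fin N}
    (hlt : ∀ b ∈ A, b.1 < b.2) (hA : ∀ b ∈ A, b.1 < j → b.1 ∈ L ∧ j < b.2)
    (hL : ∀ i ∈ L, i < j ∧ ∃ b ∈ A, b.1 = i) (hinj : ∀ b ∈ A, ∀ c ∈ A, b.1 = c.1 → b = c)
    (hkL : k ∉ L) (hkj : k < j) :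
    nestings (insert (k, j) A) = nestings A + (L.filter (· < k)).card := by
  have hkA : (k, j) ∉ A := fun h => hkL (hA _ h hkj).1
  have hcard : (L.filter (· < k)).card = (A.filter fun b => b.1 < k).card := by
    symm
    refine Finset.card_bij (fun b _ => b.1) ?_ ?_ ?_
    · intro b hb
      simp only [Finset.mem_filter] at hb ⊢
      exact ⟨(hA b hb.1 (hb.2.trans hkj)).1, hb.2⟩
    · intro b hb c hc h
      exact hinj b (Finset.mem_filter.1 hb).1 c (Finset.mem_filter.1 hc).1 h
    · intro i hi
      rw [Finset.mem_filter] at hi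
      obtain ⟨hij, b, hb, rfl⟩ := hL i hi.1
      exact ⟨b, Finset.mem_filter.2 ⟨hb, hi.2⟩, rfl⟩
  have hset : ((insert (k, j) A ×ˢ insert (k, j) A).filter fun p =>
        p.1.1 < p.2.1 ∧ p.2.2 < p.1.2) =
      ((A ×ˢ A).filter fun p => p.1.1 < p.2.1 ∧ p.2.2 < p.1.2) ∪
        (A.filter fun b => b.1 < k).map ⟨fun b => (b, (k, j)), fun a b h => by
          simpa using h⟩ := by
    ext ⟨a, b⟩
    simp only [Finset.mem_filter, Finset.mem_product, Finset.mem_insert, Finset.mem_union,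
      Finset.mem_map]
    constructor
    · rintro ⟨⟨ha | ha, hb | hb⟩, h1, h2⟩
      · subst ha hb; exact absurd h1 (lt_irrefl _)
      -- Nothing is nested inside the new arc, since an arc starting before `j` ends after `j`.
      · subst ha
        exact absurd h2 (not_lt.2 (hA b hb ((hlt b hb).trans h2)).2.le)
      · subst hb; exact Or.inr ⟨a, ⟨ha, h1⟩, rfl⟩
      · exact Or.inl ⟨⟨ha, hb⟩, h1, h2⟩
    · rintro (⟨⟨ha, hb⟩, h⟩ | ⟨c, ⟨hc, h1⟩, h⟩)
      · exact ⟨⟨Or.inr ha, Or.inr hb⟩, h⟩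
      · obtain ⟨rfl, rfl⟩ := Prod.mk.inj h
        exact ⟨⟨Or.inr hc, Or.inl rfl⟩, h1, (hA c hc (h1.trans hkj)).2⟩
  rw [nestings, hset, Finset.card_union_of_disjoint, Finset.card_map, ← hcard, nestings]
  rw [Finset.disjoint_left]
  rintro ⟨a, b⟩ h h'
  simp only [Finset.mem_filter, Finset.mem_product, Finset.mem_map] at h h'
  obtain ⟨c, -, h'⟩ := h'
  obtain ⟨rfl, rfl⟩ := Prod.mk.inj h'
  exact hkA h.1.2

theorem blockArcs_pair {k j : Fin N} (hkj : k < j) : blockArcs {k, j} = {(k, j)} := by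
  ext ⟨a, b⟩
  simp only [mem_blockArcs, Finset.mem_insert, Finset.mem_singleton, Prod.mk.injEq]
  constructor
  · rintro ⟨rfl | rfl, rfl | rfl, h, -⟩
    · exact absurd h (lt_irrefl _)
    · exact ⟨rfl, rfl⟩
    · exact absurd h hkj.not_gt
    · exact absurd h (lt_irrefl _)
  · rintro ⟨rfl, rfl⟩
    refine ⟨Or.inl rfl, Or.inr rfl, hkj, ?_⟩
    rintro c (rfl | rfl) ⟨h1, h2⟩
    · exact lt_irrefl _ h1
    · exact lt_irrefl _ h2

/-- Since `j` is the minimum of `B` and `k` precedes it, the old arcs survive and the only new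
consecutive pair is `(k, j)`. -/
theorem blockArcs_insert {B : Finset (Fin N)} {k j : Fin N} (hkj : k < j) (hj : j ∈ B)
    (hmin : ∀ i ∈ B, j ≤ i) : blockArcs (insert k B) = insert (k, j) (blockArcs B) := by
  ext ⟨a, b⟩
  simp only [mem_blockArcs, Finset.mem_insert, Prod.mk.injEq]
  constructor
  · rintro ⟨ha | ha, hb | hb, h, hn⟩
    · subst ha hb; exact absurd h (lt_irrefl _)
    · subst ha
      refine Or.inl ⟨rfl, le_antisymm ?_ (hmin b hb)⟩
      exact not_lt.1 fun h' => hn j (Or.inr hj) ⟨hkj, h'⟩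
    · subst hb
      exact absurd h (hkj.trans_le (hmin a ha)).not_gt
    · exact Or.inr ⟨ha, hb, h, fun c hc => hn c (Or.inr hc)⟩
  · rintro (⟨rfl, rfl⟩ | ⟨ha, hb, h, hn⟩)
    · refine ⟨Or.inl rfl, Or.inr hj, hkj, ?_⟩
      rintro c (rfl | hc) ⟨h1, h2⟩
      · exact lt_irrefl _ h1
      · exact absurd h2 (hmin c hc).not_gt
    · refine ⟨Or.inr ha, Or.inr hb, h, ?_⟩
      rintro c (rfl | hc) ⟨h1, h2⟩
      · exact absurd h1 (hkj.trans_le (hmin a ha)).not_gt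
      · exact hn c hc ⟨h1, h2⟩

end Arcs

/-! ### Partitions with separated open points -/

section Admissible

variable {N : ℕ}

/-- `P` is a partition of `S` without singleton blocks, in which distinct points of `L` are in
distinct blocks. -/
structure Admissible (S L : Finset (Fin N)) (P : Finset (Finset (Fin N))) : Prop where
  cover : ∀ a, a ∈ S ↔ ∃ B ∈ P, a ∈ B
  eq_of_mem : ∀ B ∈ P, ∀ C ∈ P, ∀ a, a ∈ B → a ∈ C → B = C
  two_le : ∀ B ∈ P, 2 ≤ B.card
  separated : ∀ B ∈ P, ∀ a ∈ B, ∀ b ∈ B, a ∈ L → b ∈ L → a = b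

open Classical in
/-- The finset of admissible partitions. -/
def admissible (S L : Finset (Fin N)) : Finset (Finset (Finset (Fin N))) :=
  Finset.univ.filter (Admissible S L)

theorem mem_admissible {S L : Finset (Fin N)} {P : Finset (Finset (Fin N))} :
    P ∈ admissible S L ↔ Admissible S L P := by
  simp [admissible]

/-- If the points of `S` before `j` are those of `L`, the arcs of an admissible partition of `S`
starting before `j` are issued from all points of `L`, and end after `j`. -/
theorem Admissible.arcs_spec {S L L' : Finset (Fin N)} {P : Finset (Finset (Fin N))} {j : Fin N}
    (h : Admissible S L' P) (hLL' : L ⊆ L') (hLS : L ⊆ S) (hL : ∀ i ∈ L, i < j)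
    (hS : ∀ i ∈ S, i < j → i ∈ L) (hj : j ∈ S → j ∈ L') :
    (∀ b ∈ familyArcs P, b.1 < b.2) ∧
    (∀ b ∈ familyArcs P, b.1 < j → b.1 ∈ L ∧ j < b.2) ∧
    (∀ i ∈ L, i < j ∧ ∃ b ∈ familyArcs P, b.1 = i) ∧
    (∀ b ∈ familyArcs P, ∀ c ∈ familyArcs P, b.1 = c.1 → b = c) := by
  refine ⟨?_, ?_, ?_, ?_⟩
  · intro b hb
    obtain ⟨B, hB, hb⟩ := mem_familyArcs.1 hb
    exact (mem_blockArcs.1 hb).2.2.1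
  · intro b hb hbj
    obtain ⟨B, hB, hb⟩ := mem_familyArcs.1 hb
    obtain ⟨h1, h2, h3, -⟩ := mem_blockArcs.1 hb
    have hbL := hS b.1 ((h.cover _).2 ⟨B, hB, h1⟩) hbj
    refine ⟨hbL, ?_⟩
    have hb2 : b.2 ∈ S := (h.cover _).2 ⟨B, hB, h2⟩
    -- The start of the arc already lies in `L'`, so separation keeps its end out of `L'`; this
    -- excludes both an end before `j` and an end at `j`.
    have hnot : b.2 ∉ L' := fun h' =>
      h3.ne (h.separated B hB _ h1 _ h2 (hLL' hbL) h')
    rcases lt_trichotomy b.2 j with hlt | heq | hgt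
    · exact absurd (hLL' (hS _ hb2 hlt)) hnot
    · exact absurd (heq ▸ hj (heq ▸ hb2)) hnot
    · exact hgt
  · intro i hi
    refine ⟨hL i hi, ?_⟩
    obtain ⟨B, hB, hiB⟩ := (h.cover i).1 (hLS hi)
    obtain ⟨c, hc, hci⟩ := Finset.exists_mem_ne (h.two_le B hB) i
    -- A companion of `i` before `i` would also lie in `L`, against separation.
    have hic : i < c := by
      rcases lt_trichotomy c i with h' | h' | h'
      · have : c ∈ L := hS c ((h.cover _).2 ⟨B, hB, hc⟩) (h'.trans (hL i hi))
        exact absurd (h.separated B hB c hc i hiB (hLL' this) (hLL' hi)) hci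
      · exact absurd h' hci
      · exact h'
    have hne : (B.filter (i < ·)).Nonempty := ⟨c, by simp [hc, hic]⟩
    have hm := Finset.min'_mem _ hne
    rw [Finset.mem_filter] at hm
    refine ⟨(i, (B.filter (i < ·)).min' hne), mem_familyArcs.2 ⟨B, hB, ?_⟩, rfl⟩
    refine mem_blockArcs.2 ⟨hiB, hm.1, hm.2, ?_⟩
    rintro d hd ⟨h1, h2⟩
    exact absurd h2 (Finset.min'_le _ _ (Finset.mem_filter.2 ⟨hd, h1⟩)).not_gt
  · intro b hb c hc hbc
    obtain ⟨B, hB, hb⟩ := mem_familyArcs.1 hb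
    obtain ⟨C, hC, hc⟩ := mem_familyArcs.1 hc
    obtain ⟨b1, b2, b3, b4⟩ := mem_blockArcs.1 hb
    obtain ⟨c1, c2, c3, c4⟩ := mem_blockArcs.1 hc
    obtain rfl := h.eq_of_mem B hB C hC b.1 b1 (hbc ▸ c1)
    refine Prod.ext hbc (le_antisymm ?_ ?_)
    · exact not_lt.1 fun h' => b4 _ c2 ⟨hbc ▸ c3, h'⟩
    · exact not_lt.1 fun h' => c4 _ b2 ⟨hbc ▸ b3, h'⟩

end Admissible

/-! ### Closing a block by a pair, and shortening or extending a block at its start -/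

section Moves

variable {N : ℕ} {S L : Finset (Fin N)} {P : Finset (Finset (Fin N))} {j k : Fin N}

theorem Admissible.erase_pair (h : Admissible S L P) (hkj : {k, j} ∈ P) :
    Admissible ((S.erase k).erase j) (L.erase k) (P.erase {k, j}) where
  cover a := by
    simp only [Finset.mem_erase, h.cover]
    constructor
    · rintro ⟨haj, hak, B, hB, ha⟩
      refine ⟨B, ⟨?_, hB⟩, ha⟩
      rintro rfl
      simp [haj, hak] at ha
    · rintro ⟨B, ⟨hne, hB⟩, ha⟩
      refine ⟨?_, ?_, B, hB, ha⟩
      · rintro rfl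
        exact hne (h.eq_of_mem _ hB _ hkj a ha (by simp))
      · rintro rfl
        exact hne (h.eq_of_mem _ hB _ hkj a ha (by simp))
  eq_of_mem B hB C hC := h.eq_of_mem B (Finset.mem_of_mem_erase hB) C (Finset.mem_of_mem_erase hC)
  two_le B hB := h.two_le B (Finset.mem_of_mem_erase hB)
  separated B hB a ha b hb ha' hb' := h.separated B (Finset.mem_of_mem_erase hB) a ha b hb
    (Finset.mem_of_mem_erase ha') (Finset.mem_of_mem_erase hb')

theorem Admissible.notMem_of_notMem (h : Admissible S L P) (hk : k ∉ S)
    {B : Finset (Fin N)} (hB : B ∈ P) : k ∉ B := fun hkB => hk ((h.cover k).2 ⟨B, hB, hkB⟩)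

theorem Admissible.insert_pair (h : Admissible ((S.erase k).erase j) (L.erase k) P)
    (hkS : k ∈ S) (hjS : j ∈ S) (hkj : k ≠ j) (hjL : j ∉ L) :
    Admissible S L (insert {k, j} P) := by
  have hk : ∀ B ∈ P, k ∉ B := fun B hB => h.notMem_of_notMem (by simp) hB
  have hj : ∀ B ∈ P, j ∉ B := fun B hB => h.notMem_of_notMem (by simp) hB
  refine ⟨fun a => ?_, ?_, ?_, ?_⟩
  · have := h.cover a
    simp only [Finset.mem_erase] at this
    simp only [Finset.mem_insert, exists_eq_or_imp, Finset.mem_singleton, ← this]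
    constructor
    · intro ha
      tauto
    · rintro ((rfl | rfl) | h') <;> tauto
  · intro B hB C hC a haB haC
    rw [Finset.mem_insert] at hB hC
    rcases hB with rfl | hB <;> rcases hC with rfl | hC
    · rfl
    · simp only [Finset.mem_insert, Finset.mem_singleton] at haB
      rcases haB with rfl | rfl
      · exact absurd haC (hk C hC)
      · exact absurd haC (hj C hC)
    · simp only [Finset.mem_insert, Finset.mem_singleton] at haC
      rcases haC with rfl | rfl
      · exact absurd haB (hk B hB)
      · exact absurd haB (hj B hB)
    · exact h.eq_of_mem B hB C hC a haB haC
  · intro B hB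
    rcases Finset.mem_insert.1 hB with rfl | hB
    · rw [Finset.card_pair hkj]
    · exact h.two_le B hB
  · intro B hB a ha b hb haL hbL
    rcases Finset.mem_insert.1 hB with rfl | hBP
    · simp only [Finset.mem_insert, Finset.mem_singleton] at ha hb
      rcases ha with rfl | rfl
      · rcases hb with rfl | rfl
        · rfl
        · exact absurd hbL hjL
      · exact absurd haL hjL
    · refine h.separated B hBP a ha b hb (Finset.mem_erase.2 ⟨?_, haL⟩) (Finset.mem_erase.2 ⟨?_, hbL⟩)
      · rintro rfl; exact hk B hBP ha
      · rintro rfl; exact hk B hBP hb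

/-- Adds the point `k` to the block of `j`. -/
def attach (k j : Fin N) (B : Finset (Fin N)) : Finset (Fin N) :=
  if j ∈ B then insert k B else B

/-- Reverse of the gauge move: once `k` is forgotten, `j` takes over as the marked point of its
block. Excluding the block `{k, j}` is what prevents a singleton. -/
theorem Admissible.image_erase (h : Admissible S L P) {B : Finset (Fin N)} (hB : B ∈ P)
    (hkB : k ∈ B) (hjB : j ∈ B) (hne : B ≠ {k, j}) (hkj : k ≠ j) (hkL : k ∈ L) :
    Admissible (S.erase k) (insert j (L.erase k)) (P.image (·.erase k)) where
  cover a := by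
    simp only [Finset.mem_erase, Finset.mem_image, exists_exists_and_eq_and, h.cover a]
    tauto
  eq_of_mem := by
    simp only [Finset.forall_mem_image, Finset.mem_erase]
    intro B hB C hC a haB haC
    rw [h.eq_of_mem B hB C hC a haB.2 haC.2]
  two_le := by
    simp only [Finset.forall_mem_image]
    intro C hC
    by_cases hkC : k ∈ C
    · obtain rfl := h.eq_of_mem B hB C hC k hkB hkC
      -- Strict inclusion gives `B` at least three points, so two remain after the erasure.
      have hsub : ({k, j} : Finset (Fin N)) ⊂ B := by
        refine lt_of_le_of_ne ?_ hne.symm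
        simp [Finset.insert_subset_iff, hkB, hjB]
      have := Finset.card_lt_card hsub
      rw [Finset.card_pair hkj] at this
      rw [Finset.card_erase_of_mem hkB]
      omega
    · rw [Finset.erase_eq_of_notMem hkC]
      exact h.two_le C hC
  separated := by
    -- With `k` gone, no old marked point of `B` competes with `j`.
    have key : ∀ a ∈ B, a ∈ L → a = k := fun a ha haL => h.separated B hB a ha k hkB haL hkL
    simp only [Finset.forall_mem_image, Finset.mem_erase, Finset.mem_insert]
    rintro C hC a ⟨hak, haC⟩ b ⟨hbk, hbC⟩ ha hb
    rcases ha with rfl | ha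
    · obtain rfl := h.eq_of_mem B hB C hC a hjB haC
      rcases hb with rfl | hb
      · rfl
      · exact absurd (key b hbC hb.2) hbk
    · rcases hb with rfl | hb
      · obtain rfl := h.eq_of_mem B hB C hC b hjB hbC
        exact absurd (key a haC ha.2) hak
      · exact h.separated C hC a haC b hbC ha.2 hb.2

/-- The mark on `j` ensures that its block has no other marked point, so the mark can be handed over
to `k`. -/
theorem Admissible.image_attach (h : Admissible (S.erase k) (insert j (L.erase k)) P)
    (hkS : k ∈ S) (hjS : j ∈ S) (hkj : k ≠ j) (hjL : j ∉ L) :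
    Admissible S L (P.image (attach k j)) := by
  have hk : ∀ B ∈ P, k ∉ B := fun B hB => h.notMem_of_notMem (by simp) hB
  obtain ⟨B, hB, hjB⟩ := (h.cover j).1 (Finset.mem_erase.2 ⟨hkj.symm, hjS⟩)
  have hatt : ∀ C a, a ∈ attach k j C ↔ a ∈ C ∨ (a = k ∧ j ∈ C) := by
    intro C a
    unfold attach
    split_ifs with hC <;> simp [hC, or_comm]
  refine ⟨fun a => ?_, ?_, ?_, ?_⟩
  · simp only [Finset.mem_image, exists_exists_and_eq_and, hatt]
    have := h.cover a
    rw [Finset.mem_erase] at this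
    constructor
    · intro ha
      by_cases hak : a = k
      · exact ⟨B, hB, Or.inr ⟨hak, hjB⟩⟩
      · obtain ⟨C, hC, haC⟩ := this.1 ⟨hak, ha⟩
        exact ⟨C, hC, Or.inl haC⟩
    · rintro ⟨C, hC, haC | ⟨rfl, -⟩⟩
      · exact (this.2 ⟨C, hC, haC⟩).2
      · exact hkS
  · simp only [Finset.forall_mem_image, hatt]
    rintro C hC D hD a (haC | ⟨rfl, haC⟩) (haD | ⟨h', haD⟩)
    · rw [h.eq_of_mem C hC D hD a haC haD]
    · exact absurd (h' ▸ haC) (hk C hC)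
    · exact absurd haD (hk D hD)
    · rw [h.eq_of_mem C hC D hD j haC haD]
  · simp only [Finset.forall_mem_image]
    intro C hC
    refine (h.two_le C hC).trans (Finset.card_le_card fun a ha => (hatt C a).2 (Or.inl ha))
  · simp only [Finset.forall_mem_image, hatt]
    have key : ∀ C ∈ P, ∀ a ∈ C, j ∈ C → a ∈ L → False := by
      intro C hC a haC hjC haL
      have hak : a ≠ k := fun h' => hk C hC (h' ▸ haC)
      have := h.separated C hC a haC j hjC (by simp [hak, haL]) (by simp)
      exact hjL (this ▸ haL)
    rintro C hC a (haC | ⟨rfl, haC⟩) b (hbC | ⟨rfl, hbC⟩) haL hbL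
    · refine h.separated C hC a haC b hbC ?_ ?_ <;>
        refine Finset.mem_insert_of_mem (Finset.mem_erase.2 ⟨?_, by assumption⟩)
      · rintro rfl; exact hk C hC haC
      · rintro rfl; exact hk C hC hbC
    · exact (key C hC a haC hbC haL).elim
    · exact (key C hC b hbC haC hbL).elim
    · rfl

theorem Admissible.image_attach_eq (h : Admissible S L P) {B : Finset (Fin N)} (hB : B ∈ P)
    (hjB : j ∈ B) : P.image (attach k j) = insert (insert k B) (P.erase B) := by
  conv_lhs => rw [← Finset.insert_erase hB]
  rw [Finset.image_insert, attach, if_pos hjB]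
  congr 1
  conv_rhs => rw [← Finset.image_id (s := P.erase B)]
  refine Finset.image_congr fun C hC => ?_
  rw [Finset.mem_coe, Finset.mem_erase] at hC
  exact if_neg fun hjC => hC.1 (h.eq_of_mem C hC.2 B hB j hjC hjB)

theorem Admissible.erase_attach (h : Admissible S L P) (hk : k ∉ S) :
    (P.image (attach k j)).image (·.erase k) = P := by
  rw [Finset.image_image]
  conv_rhs => rw [← Finset.image_id (s := P)]
  refine Finset.image_congr fun C hC => ?_
  have hkC := h.notMem_of_notMem hk hC
  simp only [Function.comp_apply, attach, id]
  split_ifs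
  · exact Finset.erase_insert hkC
  · exact Finset.erase_eq_of_notMem hkC

theorem Admissible.attach_erase (h : Admissible S L P) {B : Finset (Fin N)} (hB : B ∈ P)
    (hkB : k ∈ B) (hjB : j ∈ B) (hkj : k ≠ j) :
    (P.image (·.erase k)).image (attach k j) = P := by
  rw [Finset.image_image]
  conv_rhs => rw [← Finset.image_id (s := P)]
  refine Finset.image_congr fun C hC => ?_
  simp only [Function.comp_apply, attach, id, Finset.mem_erase]
  split_ifs with hjC
  · obtain rfl := h.eq_of_mem B hB C hC j hjB hjC.2
    exact Finset.insert_erase hkB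
  · refine Finset.erase_eq_of_notMem fun hkC => hjC ⟨hkj.symm, ?_⟩
    obtain rfl := h.eq_of_mem B hB C hC k hkB hkC
    exact hjB

end Moves

/-! ### Weights of partitions and their recursion -/

section Factor

variable {N : ℕ} {H : Type*} [NormedAddCommGroup H] [InnerProductSpace ℂ H]

/-- The factor of a block, with value `1` for the empty block. -/
def factor (x : Fin N → H) (T : Fin N → H →L[ℂ] H) (B : Finset (Fin N)) : ℂ :=
  if hB : B.Nonempty then blockFactor x T B hB else 1

theorem factor_eq {x : Fin N → H} {T : Fin N → H →L[ℂ] H} {B : Finset (Fin N)} {a b : Fin N}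
    (ha : a ∈ B) (hb : b ∈ B) (hmin : ∀ i ∈ B, a ≤ i) (hmax : ∀ i ∈ B, i ≤ b) :
    factor x T B = inner ℂ (x b)
      (((((B.erase a).erase b).sort (· ≤ ·)).map T).reverse.prod (x a)) := by
  have hB : B.Nonempty := ⟨a, ha⟩
  have h1 : B.min' hB = a := le_antisymm (Finset.min'_le _ _ ha) (hmin _ (Finset.min'_mem _ _))
  have h2 : B.max' hB = b := le_antisymm (hmax _ (Finset.max'_mem _ _)) (Finset.le_max' _ _ hb)
  rw [factor, dif_pos hB, blockFactor, h1, h2]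

theorem factor_pair (x : Fin N → H) (T : Fin N → H →L[ℂ] H) {k j : Fin N} (hkj : k < j) :
    factor x T {k, j} = inner ℂ (x j) (x k) := by
  rw [factor_eq (a := k) (b := j) (by simp) (by simp) (by simp [hkj.le]) (by simp [hkj.le])]
  have : (({k, j} : Finset (Fin N)).erase k).erase j = ∅ := by
    ext a
    simp only [Finset.mem_erase, Finset.mem_insert, Finset.mem_singleton, Finset.notMem_empty]
    tauto
  rw [this]
  simp

theorem factor_update_of_notMem (x : Fin N → H) (T : Fin N → H →L[ℂ] H) {j : Fin N} (v : H)
    {B : Finset (Fin N)} (hj : j ∉ B) : factor (Function.update x j v) T B = factor x T B := by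
  unfold factor
  split_ifs with hB
  · unfold blockFactor
    rw [Function.update_of_ne, Function.update_of_ne]
    · exact fun h => hj (h ▸ Finset.min'_mem _ _)
    · exact fun h => hj (h ▸ Finset.max'_mem _ _)
  · rfl

/-- Prepending `k` turns `j` from first point into first interior point. Thus `T j` acts on `x k`
before all other operators, which is the same as starting the shorter block from the vector `T j (x
k)`. -/
theorem factor_insert (x : Fin N → H) (T : Fin N → H →L[ℂ] H) {k j : Fin N} (hkj : k < j)
    {B : Finset (Fin N)} (hj : j ∈ B) (hmin : ∀ i ∈ B, j ≤ i) (hcard : 2 ≤ B.card) :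
    factor x T (insert k B) = factor (Function.update x j (T j (x k))) T B := by
  have hB : B.Nonempty := ⟨j, hj⟩
  have hb := Finset.max'_mem B hB
  set b := B.max' hB with hbdef
  have hmax : ∀ i ∈ B, i ≤ b := fun i hi => Finset.le_max' _ _ hi
  have hkB : k ∉ B := fun h => absurd (hmin k h) hkj.not_ge
  -- As `B` has a second point, its maximum is not `j`, and the update does not touch the vector on
  -- the left of the inner product.
  have hbj : b ≠ j := by
    intro h
    obtain ⟨c, hc, hcj⟩ := Finset.exists_mem_ne hcard j
    exact hcj (le_antisymm (h ▸ hmax c hc) (hmin c hc))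
  rw [factor_eq (a := j) (b := b) hj hb hmin hmax,
    factor_eq (a := k) (b := b) (by simp) (by simp [hb])
      (by simpa using fun i hi => hkj.le.trans (hmin i hi))
      (by simpa using ⟨hkj.le.trans (hmax j hj), hmax⟩)]
  have hsort : ((insert k B).erase k).erase b = insert j ((B.erase j).erase b) := by
    rw [Finset.erase_insert hkB, Finset.erase_right_comm,
      Finset.insert_erase (Finset.mem_erase.2 ⟨hbj.symm, hj⟩)]
  rw [hsort, Finset.sort_insert]
  · simp [Function.update_of_ne hbj]
  · intro i hi
    exact hmin i (Finset.mem_of_mem_erase (Finset.mem_of_mem_erase hi))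
  · simp

/-- The contribution of a partition. -/
def weight (q t : ℝ) (x : Fin N → H) (T : Fin N → H →L[ℂ] H) (P : Finset (Finset (Fin N))) : ℂ :=
  (q : ℂ) ^ crossings (familyArcs P) * (t : ℂ) ^ nestings (familyArcs P) * ∏ B ∈ P, factor x T B

variable {S L : Finset (Fin N)} {P : Finset (Finset (Fin N))} {j k : Fin N}

/-- The annihilation step: when `{k, j}` closes, the other marked points each have an outgoing arc
passing over `j`, which contributes a `t` or a `q` according to its side of `k`. -/
theorem weight_insert_pair (q t : ℝ) (x : Fin N → H) (T : Fin N → H →L[ℂ] H)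
    (h : Admissible ((S.erase k).erase j) (L.erase k) P) (hLS : L ⊆ S)
    (hL : ∀ i ∈ L, i < j) (hS : ∀ i ∈ S, i < j → i ∈ L) (hk : k ∈ L) :
    weight q t x T (insert {k, j} P) =
      (t : ℂ) ^ ((L.erase k).filter (· < k)).card * (q : ℂ) ^ ((L.erase k).filter (k < ·)).card *
        inner ℂ (x j) (x k) * weight q t x T P := by
  have hkj := hL k hk
  have hP : ({k, j} : Finset (Fin N)) ∉ P := fun hP =>
    h.notMem_of_notMem (k := k) (by simp) hP (by simp)
  obtain ⟨h1, h2, h3, h4⟩ := h.arcs_spec (j := j) (L := L.erase k) subset_rfl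
    (fun i hi => by
      have := hL i (Finset.mem_of_mem_erase hi)
      simp only [Finset.mem_erase] at hi ⊢
      exact ⟨this.ne, hi.1, hLS hi.2⟩)
    (fun i hi => hL i (Finset.mem_of_mem_erase hi))
    (fun i hi hij => by
      simp only [Finset.mem_erase] at hi ⊢
      exact ⟨hi.2.1, hS i hi.2.2 hij⟩)
    (fun hj => by simp at hj)
  have harcs : familyArcs (insert {k, j} P) = insert (k, j) (familyArcs P) := by
    rw [familyArcs, Finset.biUnion_insert, blockArcs_pair hkj, Finset.singleton_union, familyArcs]
  rw [weight, harcs, crossings_insert h2 h3 h4 (by simp) hkj,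
    nestings_insert h1 h2 h3 h4 (by simp) hkj, Finset.prod_insert hP, factor_pair x T hkj, weight]
  ring

/-- The gauge step: the new arc costs the same powers as when a pair is closed, and the inner vector
is absorbed into the slot at `j`. -/
theorem weight_image_attach (q t : ℝ) (x : Fin N → H) (T : Fin N → H →L[ℂ] H)
    (h : Admissible (S.erase k) (insert j (L.erase k)) P) (hLS : L ⊆ S) (hjS : j ∈ S)
    (hL : ∀ i ∈ L, i < j) (hS : ∀ i ∈ S, i < j → i ∈ L) (hk : k ∈ L) :
    weight q t x T (P.image (attach k j)) =
      (t : ℂ) ^ ((L.erase k).filter (· < k)).card * (q : ℂ) ^ ((L.erase k).filter (k < ·)).card *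
        weight q t (Function.update x j (T j (x k))) T P := by
  have hkj := hL k hk
  obtain ⟨B, hB, hjB⟩ := (h.cover j).1 (Finset.mem_erase.2 ⟨hkj.ne', hjS⟩)
  -- Everything remaining before `j` is marked, and so is `j`; hence no earlier point shares its
  -- block.
  have hmin : ∀ i ∈ B, j ≤ i := by
    intro i hi
    by_contra! hij
    have hi' := Finset.mem_erase.1 ((h.cover i).2 ⟨B, hB, hi⟩)
    exact hij.ne (h.separated B hB i hi j hjB
      (by simp [hi'.1, hS i hi'.2 hij]) (by simp))
  have hP : insert k B ∉ P := fun hP =>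
    h.notMem_of_notMem (k := k) (by simp) hP (by simp)
  obtain ⟨h1, h2, h3, h4⟩ := h.arcs_spec (j := j) (L := L.erase k) (Finset.subset_insert _ _)
    (Finset.erase_subset_erase _ hLS)
    (fun i hi => hL i (Finset.mem_of_mem_erase hi))
    (fun i hi hij => by
      simp only [Finset.mem_erase] at hi ⊢
      exact ⟨hi.1, hS i hi.2 hij⟩)
    (fun hj => by simp)
  have harcs : familyArcs (P.image (attach k j)) = insert (k, j) (familyArcs P) := by
    conv_rhs => rw [← Finset.insert_erase hB]
    rw [h.image_attach_eq hB hjB, familyArcs, Finset.biUnion_insert, familyArcs,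
      Finset.biUnion_insert, blockArcs_insert hkj hjB hmin, Finset.insert_union]
  have hprod : ∏ C ∈ P.image (attach k j), factor x T C =
      ∏ C ∈ P, factor (Function.update x j (T j (x k))) T C := by
    rw [h.image_attach_eq hB hjB, Finset.prod_insert (fun h' => hP (Finset.mem_of_mem_erase h')),
      ← Finset.mul_prod_erase P _ hB, factor_insert x T hkj hjB hmin (h.two_le B hB)]
    congr 1
    refine Finset.prod_congr rfl fun C hC => (factor_update_of_notMem x T _ fun hjC => ?_).symm
    rw [Finset.mem_erase] at hC
    exact hC.1 (h.eq_of_mem C hC.2 B hB j hjC hjB)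
  rw [weight, harcs, crossings_insert h2 h3 h4 (by simp) hkj,
    nestings_insert h1 h2 h3 h4 (by simp) hkj, hprod, weight]
  ring

/-- The partitions in which `j` and `k` share a block. -/
def linked (S L : Finset (Fin N)) (k j : Fin N) : Finset (Finset (Finset (Fin N))) :=
  (admissible S L).filter fun P => ∃ B ∈ P, k ∈ B ∧ j ∈ B

/-- Either `{k, j}` is a whole block and can be removed, or the block is larger and `k` can be
erased from it. Both operations are bijections. -/
theorem sum_linked (q t : ℝ) (x : Fin N → H) (T : Fin N → H →L[ℂ] H)
    (hLS : L ⊆ S) (hjS : j ∈ S)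
    (hL : ∀ i ∈ L, i < j) (hS : ∀ i ∈ S, i < j → i ∈ L) (hk : k ∈ L) :
    ∑ P ∈ linked S L k j, weight q t x T P =
      (t : ℂ) ^ ((L.erase k).filter (· < k)).card * (q : ℂ) ^ ((L.erase k).filter (k < ·)).card *
        (inner ℂ (x j) (x k) *
            ∑ P ∈ admissible ((S.erase k).erase j) (L.erase k), weight q t x T P +
          ∑ P ∈ admissible (S.erase k) (insert j (L.erase k)),
            weight q t (Function.update x j (T j (x k))) T P) := by
  have hkj := hL k hk
  have hjL : j ∉ L := fun h => lt_irrefl _ (hL j h)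
  rw [← Finset.sum_filter_add_sum_filter_not _ (fun P => ({k, j} : Finset (Fin N)) ∈ P), mul_add]
  congr 1
  · rw [← mul_assoc, Finset.mul_sum]
    refine Finset.sum_bij' (fun P _ => P.erase {k, j}) (fun P _ => insert {k, j} P) ?_ ?_ ?_ ?_ ?_
    · intro P hP
      simp only [linked, Finset.mem_filter, mem_admissible] at hP ⊢
      exact hP.1.1.erase_pair hP.2
    · intro P hP
      rw [mem_admissible] at hP
      simp only [linked, Finset.mem_filter, mem_admissible]
      exact ⟨⟨hP.insert_pair (hLS hk) hjS hkj.ne hjL, {k, j}, by simp⟩, by simp⟩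
    · intro P hP
      exact Finset.insert_erase (Finset.mem_filter.1 hP).2
    · intro P hP
      rw [mem_admissible] at hP
      exact Finset.erase_insert fun h => hP.notMem_of_notMem (k := k) (by simp) h (by simp)
    · intro P hP
      simp only [linked, Finset.mem_filter, mem_admissible] at hP
      rw [← weight_insert_pair q t x T (hP.1.1.erase_pair hP.2) hLS hL hS hk,
        Finset.insert_erase hP.2]
  · rw [Finset.mul_sum]
    refine Finset.sum_bij' (fun P _ => P.image (·.erase k)) (fun P _ => P.image (attach k j))
      ?_ ?_ ?_ ?_ ?_
    · intro P hP
      simp only [linked, Finset.mem_filter, mem_admissible] at hP ⊢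
      obtain ⟨⟨h, B, hB, hkB, hjB⟩, hP⟩ := hP
      exact h.image_erase hB hkB hjB (fun h' => hP (h' ▸ hB)) hkj.ne hk
    · intro P hP
      rw [mem_admissible] at hP
      have h := hP.image_attach (hLS hk) hjS hkj.ne hjL
      obtain ⟨B, hB, hjB⟩ := (hP.cover j).1 (Finset.mem_erase.2 ⟨hkj.ne', hjS⟩)
      have hmem : insert k B ∈ P.image (attach k j) := by
        rw [hP.image_attach_eq hB hjB]; simp
      simp only [linked, Finset.mem_filter, mem_admissible]
      -- The extended block has at least three points, so it cannot be the pair `{k, j}`.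
      refine ⟨⟨h, insert k B, hmem, by simp, by simp [hjB]⟩, fun h' => ?_⟩
      have heq := h.eq_of_mem _ hmem _ h' k (by simp) (by simp)
      have hc := congrArg Finset.card heq
      rw [Finset.card_insert_of_notMem (hP.notMem_of_notMem (by simp) hB),
        Finset.card_pair hkj.ne] at hc
      have := hP.two_le B hB
      omega
    · intro P hP
      simp only [linked, Finset.mem_filter, mem_admissible] at hP
      obtain ⟨⟨h, B, hB, hkB, hjB⟩, hP⟩ := hP
      exact h.attach_erase hB hkB hjB hkj.ne
    · intro P hP
      rw [mem_admissible] at hP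
      exact hP.erase_attach (by simp)
    · intro P hP
      simp only [linked, Finset.mem_filter, mem_admissible] at hP
      obtain ⟨⟨h, B, hB, hkB, hjB⟩, hP⟩ := hP
      rw [← weight_image_attach q t x T
        (h.image_erase hB hkB hjB (fun h' => hP (h' ▸ hB)) hkj.ne hk) hLS hjS hL hS hk,
        h.attach_erase hB hkB hjB hkj.ne]

/-- The sum over admissible partitions, split according to the block of the first point `j` after
the points of `L`. -/
theorem sum_admissible (q t : ℝ) (x : Fin N → H) (T : Fin N → H →L[ℂ] H)
    (hLS : L ⊆ S) (hjS : j ∈ S) (hL : ∀ i ∈ L, i < j) (hS : ∀ i ∈ S, i < j → i ∈ L) :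
    ∑ P ∈ admissible S L, weight q t x T P =
      ∑ P ∈ admissible S (insert j L), weight q t x T P +
      ∑ k ∈ L, (t : ℂ) ^ ((L.erase k).filter (· < k)).card *
        (q : ℂ) ^ ((L.erase k).filter (k < ·)).card *
        (inner ℂ (x j) (x k) *
            ∑ P ∈ admissible ((S.erase k).erase j) (L.erase k), weight q t x T P +
          ∑ P ∈ admissible (S.erase k) (insert j (L.erase k)),
            weight q t (Function.update x j (T j (x k))) T P) := by
  have hjL : j ∉ L := fun h => lt_irrefl _ (hL j h)
  rw [← Finset.sum_congr rfl fun k hk => sum_linked q t x T hLS hjS hL hS hk,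
    ← Finset.sum_biUnion, ← Finset.sum_union]
  · refine Finset.sum_congr ?_ fun _ _ => rfl
    ext P
    simp only [linked, Finset.mem_union, Finset.mem_biUnion, Finset.mem_filter, mem_admissible]
    constructor
    · intro h
      by_cases hP : ∃ k ∈ L, ∃ B ∈ P, k ∈ B ∧ j ∈ B
      · obtain ⟨k, hk, hB⟩ := hP
        exact Or.inr ⟨k, hk, h, hB⟩
      · push Not at hP
        -- If `j` meets no marked point in its block, it can be marked as well: this is the creation
        -- term.
        refine Or.inl ⟨h.cover, h.eq_of_mem, h.two_le, fun B hB a ha b hb haL hbL => ?_⟩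
        rcases Finset.mem_insert.1 haL with rfl | haL'
        · rcases Finset.mem_insert.1 hbL with rfl | hbL'
          · rfl
          · exact absurd ha (hP b hbL' B hB hb)
        · rcases Finset.mem_insert.1 hbL with rfl | hbL'
          · exact absurd hb (hP a haL' B hB ha)
          · exact h.separated B hB a ha b hb haL' hbL'
    · rintro (h | ⟨k, -, h, -⟩)
      · exact ⟨h.cover, h.eq_of_mem, h.two_le, fun B hB a ha b hb haL hbL =>
          h.separated B hB a ha b hb (Finset.mem_insert_of_mem haL) (Finset.mem_insert_of_mem hbL)⟩
      · exact h
  · rw [Finset.disjoint_left]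
    intro P hP hP'
    simp only [linked, Finset.mem_biUnion, Finset.mem_filter, mem_admissible] at hP hP'
    obtain ⟨k, hk, -, B, hB, hkB, hjB⟩ := hP'
    exact (hL k hk).ne (hP.separated B hB k hkB j hjB (by simp [hk]) (by simp))
  · intro k hk l hl hkl
    rw [Function.onFun, Finset.disjoint_left]
    intro P hP hP'
    simp only [linked, Finset.mem_filter, mem_admissible] at hP hP'
    obtain ⟨h, B, hB, hkB, hjB⟩ := hP
    obtain ⟨-, C, hC, hlC, hjC⟩ := hP'
    obtain rfl := h.eq_of_mem B hB C hC j hjB hjC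
    exact hkl (h.separated B hB k hkB l hlC hk hl)

end Factor

/-! ### Tensor positions as increasing labels -/

section Slots

variable {N : ℕ}

theorem image_succAbove {m : ℕ} {s : Fin (m + 1) → Fin N} (hs : StrictMono s) (p : Fin (m + 1)) :
    Finset.univ.image (s ∘ p.succAbove) = (Finset.univ.image s).erase (s p) := by
  ext a
  simp only [Finset.mem_image, Finset.mem_univ, true_and, Finset.mem_erase, Function.comp_apply]
  constructor
  · rintro ⟨i, rfl⟩
    exact ⟨hs.injective.ne (Fin.succAbove_ne p i), _, rfl⟩
  · rintro ⟨hne, i, rfl⟩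
    obtain ⟨l, rfl⟩ := Fin.exists_succAbove_eq (fun h : i = p => hne (h ▸ rfl))
    exact ⟨l, rfl⟩

theorem image_snoc {m : ℕ} (s : Fin m → Fin N) (j : Fin N) :
    Finset.univ.image (Fin.snoc s j : Fin (m + 1) → Fin N) =
      insert j (Finset.univ.image s) := by
  ext a
  simp [Fin.exists_fin_succ', or_comm, eq_comm]

theorem strictMono_snoc {m : ℕ} {s : Fin m → Fin N} (hs : StrictMono s) {j : Fin N}
    (hj : ∀ i, s i < j) : StrictMono (Fin.snoc s j : Fin (m + 1) → Fin N) := by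
  intro a b hab
  induction b using Fin.lastCases with
  | last =>
    induction a using Fin.lastCases with
    | last => exact absurd hab (lt_irrefl _)
    | cast a => simpa using hj a
  | cast b =>
    induction a using Fin.lastCases with
    | last => exact absurd hab (Fin.castSucc_lt_last b).not_gt
    | cast a => simpa using hs (by simpa using hab)

theorem card_image_lt {m : ℕ} {s : Fin (m + 1) → Fin N} (hs : StrictMono s) (p : Fin (m + 1)) :
    (((Finset.univ.image s).erase (s p)).filter (· < s p)).card = p := by
  have : ((Finset.univ.image s).erase (s p)).filter (· < s p) = (Finset.Iio p).image s := by
    ext a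
    simp only [Finset.mem_filter, Finset.mem_erase, Finset.mem_image, Finset.mem_univ, true_and,
      Finset.mem_Iio]
    constructor
    · rintro ⟨⟨-, i, rfl⟩, h⟩
      exact ⟨i, hs.lt_iff_lt.1 h, rfl⟩
    · rintro ⟨i, h, rfl⟩
      exact ⟨⟨(hs h).ne, i, rfl⟩, hs h⟩
  rw [this, Finset.card_image_of_injective _ hs.injective, Fin.card_Iio]

theorem card_image_gt {m : ℕ} {s : Fin (m + 1) → Fin N} (hs : StrictMono s) (p : Fin (m + 1)) :
    (((Finset.univ.image s).erase (s p)).filter (s p < ·)).card = m - p := by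
  have : ((Finset.univ.image s).erase (s p)).filter (s p < ·) = (Finset.Ioi p).image s := by
    ext a
    simp only [Finset.mem_filter, Finset.mem_erase, Finset.mem_image, Finset.mem_univ, true_and,
      Finset.mem_Ioi]
    constructor
    · rintro ⟨⟨-, i, rfl⟩, h⟩
      exact ⟨i, hs.lt_iff_lt.1 h, rfl⟩
    · rintro ⟨i, h, rfl⟩
      exact ⟨⟨(hs h).ne', i, rfl⟩, hs h⟩
  rw [this, Finset.card_image_of_injective _ hs.injective, Fin.card_Ioi]
  omega

/-- Storing the appended vector in the fresh label `j` keeps every tensor of the form `x ∘ s`, as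
the induction requires. -/
theorem comp_snoc_update {N m : ℕ} {H : Type*} (x : Fin N → H) (s : Fin m → Fin N) (j : Fin N)
    (v : H) (hj : ∀ i, s i ≠ j) :
    Function.update x j v ∘ (Fin.snoc s j : Fin (m + 1) → Fin N) =
      (Fin.snoc (x ∘ s) v : Fin (m + 1) → H) := by
  funext i
  induction i using Fin.lastCases with
  | last => simp
  | cast i => simp [Function.update_of_ne (hj i)]

end Slots

/-! ### Vacuum expectations and the induction over the operators -/

section Expectation

variable {H : Type*} [NormedAddCommGroup H] [InnerProductSpace ℂ H]

/-- The elementary tensor `v₁ ⊗ ⋯ ⊗ vₘ` as an element of the Fock space. -/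
def elementary {m : ℕ} (v : Fin m → H) : Fock H :=
  DirectSum.lof ℂ ℕ (fun n => ⨂[ℂ]^n H) m (PiTensorProduct.tprod ℂ v)

theorem creation_elementary (y : H) {m : ℕ} (v : Fin m → H) :
    creation y (elementary v) = elementary (Fin.snoc v y : Fin (m + 1) → H) := by
  simp [creation, elementary, DirectSum.toModule_lof, appendLinear_apply]

theorem fieldOperator_apply (q t : ℝ) (y : H) (T : H →L[ℂ] H) (f : Fock H) :
    fieldOperator q t y T f = annihilation q t y f + creation y f + gaugeOperator q t T f := rfl

theorem annihilation_elementary_zero (q t : ℝ) (y : H) (v : Fin 0 → H) :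
    annihilation q t y (elementary v) = 0 := by
  simp [annihilation, elementary, DirectSum.toModule_lof]

theorem gaugeOperator_elementary_zero (q t : ℝ) (T : H →L[ℂ] H) (v : Fin 0 → H) :
    gaugeOperator q t T (elementary v) = 0 := by
  simp [gaugeOperator, elementary, DirectSum.toModule_lof]

theorem annihilation_elementary_succ (q t : ℝ) (y : H) {m : ℕ} (v : Fin (m + 1) → H) :
    annihilation q t y (elementary v) =
      ∑ k : Fin (m + 1), ((t : ℂ) ^ (k : ℕ) * (q : ℂ) ^ (m - (k : ℕ)) * inner ℂ y (v k)) •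
        elementary (v ∘ k.succAbove) := by
  rw [annihilation, elementary, DirectSum.toModule_lof, LinearMap.comp_apply,
    annihilationAux_tprod, map_sum]
  simp only [map_smul]
  rfl

theorem gaugeOperator_elementary_succ (q t : ℝ) (T : H →L[ℂ] H) {m : ℕ} (v : Fin (m + 1) → H) :
    gaugeOperator q t T (elementary v) =
      ∑ k : Fin (m + 1), ((t : ℂ) ^ (k : ℕ) * (q : ℂ) ^ (m - (k : ℕ))) •
        elementary (Fin.snoc (v ∘ k.succAbove) (T (v k)) : Fin (m + 1) → H) := by
  rw [gaugeOperator, elementary, DirectSum.toModule_lof, LinearMap.comp_apply,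
    gaugeAux_tprod, map_sum]
  simp only [map_smul]
  rfl

variable (H) in
/-- The linear functional `f ↦ ⟨Ω, f⟩`. -/
def vacuumFunctional (q t : ℝ) : Fock H →ₗ[ℂ] ℂ where
  toFun f := fockInner H q t f (vacuum H)
  map_add' f g := by simp
  map_smul' c f := by simp

theorem vacuumFunctional_elementary_zero (q t : ℝ) (v : Fin 0 → H) :
    vacuumFunctional H q t (elementary v) = 1 := by
  obtain rfl : v = Fin.elim0 := Subsingleton.elim _ _
  simp [vacuumFunctional, fockInner, elementary, vacuum, DirectSum.toModule_lof,
    DirectSum.component.lof_self, symmetrization, inversions, tensorInner_tprod]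

theorem vacuumFunctional_elementary_succ (q t : ℝ) {m : ℕ} (v : Fin (m + 1) → H) :
    vacuumFunctional H q t (elementary v) = 0 := by
  simp [vacuumFunctional, fockInner, elementary, vacuum, DirectSum.toModule_lof,
    DirectSum.component.of]

variable {N : ℕ}

/-- Base case of the induction. With all points marked no block of size two is possible, so only the
empty partition of the empty set occurs; likewise only degree zero pairs with `Ω`. -/
theorem sum_admissible_self (q t : ℝ) (x : Fin N → H) (T : Fin N → H →L[ℂ] H) {m : ℕ}
    (s : Fin m → Fin N) :
    ∑ P ∈ admissible (Finset.univ.image s) (Finset.univ.image s), weight q t x T P =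
      vacuumFunctional H q t (elementary (x ∘ s)) := by
  have hempty : ∀ P, Admissible (Finset.univ.image s) (Finset.univ.image s) P → P = ∅ := by
    intro P hP
    refine Finset.eq_empty_of_forall_notMem fun B hB => ?_
    obtain ⟨a, ha, b, hb, hab⟩ := Finset.one_lt_card.1 (hP.two_le B hB)
    exact hab (hP.separated B hB a ha b hb ((hP.cover a).2 ⟨B, hB, ha⟩) ((hP.cover b).2 ⟨B, hB, hb⟩))
  cases m with
  | zero =>
    rw [vacuumFunctional_elementary_zero]
    have : admissible (Finset.univ.image s) (Finset.univ.image s) = {∅} := by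
      ext P
      rw [mem_admissible, Finset.mem_singleton]
      refine ⟨hempty P, ?_⟩
      rintro rfl
      constructor <;> simp
    rw [this, Finset.sum_singleton]
    simp [weight, familyArcs, crossings, nestings]
  | succ m =>
    rw [vacuumFunctional_elementary_succ]
    refine Finset.sum_eq_zero fun P hP => ?_
    rw [mem_admissible] at hP
    obtain ⟨B, hB, -⟩ := (hP.cover (s 0)).1 (by simp)
    rw [hempty P hP] at hB
    simp at hB

/-- Here `y` holds the vectors of the operators, fixed throughout, while `x` holds the current
contents of the slots. They need to agree only on the indices still to come, since gauge steps
overwrite `x` at indices already used. -/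
theorem vacuumFunctional_prod_fieldOperator (q t : ℝ) (y : Fin N → H) (T : Fin N → H →L[ℂ] H)
    (r : List (Fin N)) (hr : r.Pairwise (· < ·)) (x : Fin N → H) (hx : ∀ i ∈ r, x i = y i)
    {m : ℕ} (s : Fin m → Fin N) (hs : StrictMono s) (hsr : ∀ i, ∀ a ∈ r, s i < a) :
    vacuumFunctional H q t
        ((r.map fun i => fieldOperator q t (y i) (T i)).reverse.prod (elementary (x ∘ s))) =
      ∑ P ∈ admissible (Finset.univ.image s ∪ r.toFinset) (Finset.univ.image s),
        weight q t x T P := by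
  induction r generalizing x m with
  | nil => simpa using (sum_admissible_self q t x T s).symm
  | cons j r ih =>
    obtain ⟨hjr, hr⟩ := List.pairwise_cons.1 hr
    have hsj : ∀ i, s i < j := fun i => hsr i j (by simp)
    have hjr' : j ∉ r := fun h => lt_irrefl _ (hjr j h)
    have hsr' : ∀ i, ∀ a ∈ r, s i < a := fun i a ha => hsr i a (by simp [ha])
    have hx' : ∀ i ∈ r, x i = y i := fun i hi => hx i (by simp [hi])
    have hcreate : vacuumFunctional H q t
        ((r.map fun i => fieldOperator q t (y i) (T i)).reverse.prod
          (elementary (Fin.snoc (x ∘ s) (y j) : Fin (m + 1) → H))) =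
        ∑ P ∈ admissible (Finset.univ.image s ∪ (j :: r).toFinset)
          (insert j (Finset.univ.image s)), weight q t x T P := by
      have h := ih hr x hx' (Fin.snoc s j : Fin (m + 1) → Fin N) (strictMono_snoc hs hsj) (by
        intro i a ha
        induction i using Fin.lastCases with
        | last => simpa using hjr a ha
        | cast i => simpa using hsr' i a ha)
      -- Creation leaves `x` unchanged; it is viewed as a trivial update so that the general slot
      -- identity applies.
      rw [image_snoc, ← Function.update_eq_self j x, comp_snoc_update _ _ _ _ fun i => (hsj i).ne,
        Function.update_eq_self, hx j (by simp)] at h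
      rw [h, List.toFinset_cons, Finset.union_insert, Finset.insert_union]
    rw [sum_admissible q t x T (j := j) Finset.subset_union_left (by simp)
      (by simpa using hsj) (by
        intro i hi hij
        simp only [Finset.mem_union, List.mem_toFinset, List.mem_cons] at hi
        rcases hi with hi | rfl | hi
        · exact hi
        · exact absurd hij (lt_irrefl _)
        · exact absurd hij (hjr i hi).not_gt), ← hcreate]
    simp only [List.map_cons, List.reverse_cons, List.prod_append, List.prod_singleton,
      Module.End.mul_apply, fieldOperator_apply, creation_elementary, map_add]
    cases m with
    | zero =>
      simp [annihilation_elementary_zero, gaugeOperator_elementary_zero]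
    | succ m =>
      -- The sum over marked points becomes a sum over tensor positions, to be compared termwise
      -- with the annihilation and gauge sums.
      rw [add_right_comm, add_comm, Finset.sum_image fun a _ b _ h => hs.injective h,
        annihilation_elementary_succ, gaugeOperator_elementary_succ]
      simp only [map_sum, map_smul, smul_eq_mul, ← Finset.sum_add_distrib]
      congr 1
      refine Finset.sum_congr rfl fun p _ => ?_
      have hS1 : ((Finset.univ.image s ∪ (j :: r).toFinset).erase (s p)).erase j =
          Finset.univ.image (s ∘ p.succAbove) ∪ r.toFinset := by
        rw [image_succAbove hs]
        ext a
        simp only [Finset.mem_erase, Finset.mem_union, List.mem_toFinset, List.mem_cons]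
        constructor
        · tauto
        · rintro (⟨h1, h2⟩ | h)
          · obtain ⟨i, -, rfl⟩ := Finset.mem_image.1 h2
            exact ⟨(hsj i).ne, h1, Or.inl h2⟩
          · exact ⟨(hjr a h).ne', (hsr' p a h).ne', Or.inr (Or.inr h)⟩
      have hS2 : (Finset.univ.image s ∪ (j :: r).toFinset).erase (s p) =
          Finset.univ.image (Fin.snoc (s ∘ p.succAbove) j : Fin (m + 1) → Fin N) ∪ r.toFinset := by
        rw [image_snoc, Finset.insert_union, ← hS1, Finset.insert_erase]
        simp [(hsj p).ne']
      have hmono : StrictMono (s ∘ p.succAbove) := hs.comp (Fin.strictMono_succAbove p)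
      have h1 := ih hr x hx' (s ∘ p.succAbove) hmono fun i => hsr' _
      have h2 := ih hr (Function.update x j (T j (x (s p))))
        (fun i hi => by
          rw [Function.update_of_ne (fun h : i = j => hjr' (h ▸ hi)), hx' i hi])
        (Fin.snoc (s ∘ p.succAbove) j : Fin (m + 1) → Fin N)
        (strictMono_snoc hmono fun i => hsj _) (by
          intro i a ha
          induction i using Fin.lastCases with
          | last => simpa using hjr a ha
          | cast i => simpa using hsr' _ a ha)
      rw [comp_snoc_update x (s ∘ p.succAbove) j _ fun i => (hsj _).ne] at h2
      rw [hS1, hS2, card_image_lt hs, card_image_gt hs, ← image_succAbove hs,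
        ← image_snoc, ← h1, ← h2, hx j (by simp)]
      simp only [Function.comp_apply, Function.comp_assoc]
      ring

/-- With no marked points the separation condition is void, and what remains is the notion of a
partition without singletons. -/
theorem sum_finpartition (q t : ℝ) (x : Fin N → H) (T : Fin N → H →L[ℂ] H) :
    ∑ π : Finpartition (Finset.univ : Finset (Fin N)) with ∀ B ∈ π.parts, 2 ≤ B.card,
        (q : ℂ) ^ rc π * (t : ℂ) ^ rarc π *
          ∏ B : π.parts, blockFactor x T B.1 (π.nonempty_of_mem_parts B.2) =
      ∑ P ∈ admissible Finset.univ ∅, weight q t x T P := by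
  refine Finset.sum_bij (fun π _ => π.parts) ?_ ?_ ?_ ?_
  · intro π hπ
    rw [Finset.mem_filter] at hπ
    rw [mem_admissible]
    refine ⟨fun a => ?_, fun B hB C hC a haB haC => π.eq_of_mem_parts hB hC haB haC, hπ.2,
      by simp⟩
    simpa using π.exists_mem (Finset.mem_univ a)
  · intro π _ ρ _ h
    exact Finpartition.ext h
  · intro P hP
    rw [mem_admissible] at hP
    refine ⟨⟨P, ?_, ?_, ?_⟩, ?_, rfl⟩
    · rw [Finset.supIndep_iff_pairwiseDisjoint]
      intro B hB C hC hBC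
      exact Finset.disjoint_left.2 fun a haB haC => hBC (hP.eq_of_mem B hB C hC a haB haC)
    · ext a
      simpa [Finset.mem_sup] using hP.cover a
    · intro h
      simpa using hP.two_le _ h
    · rw [Finset.mem_filter]
      exact ⟨Finset.mem_univ _, hP.two_le⟩
  · intro π _
    have : ∏ B : π.parts, blockFactor x T B.1 (π.nonempty_of_mem_parts B.2) =
        ∏ B ∈ π.parts, factor x T B := by
      rw [← Finset.prod_coe_sort π.parts (factor x T)]
      refine Finset.prod_congr rfl fun B _ => ?_
      rw [factor, dif_pos (π.nonempty_of_mem_parts B.2)]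
    rw [this]
    rfl

theorem vacuumState_prod_fieldOperator (q t : ℝ) (x : Fin N → H) (T : Fin N → H →L[ℂ] H) :
    vacuumState q t (List.ofFn fun i => fieldOperator q t (x i) (T i)).reverse.prod =
      ∑ π : Finpartition (Finset.univ : Finset (Fin N)) with ∀ B ∈ π.parts, 2 ≤ B.card,
        (q : ℂ) ^ rc π * (t : ℂ) ^ rarc π *
          ∏ B : π.parts, blockFactor x T B.1 (π.nonempty_of_mem_parts B.2) := by
  have h := vacuumFunctional_prod_fieldOperator q t x T (List.finRange N)
    (List.pairwise_lt_finRange N) x (fun _ _ => rfl) (Fin.elim0 : Fin 0 → Fin N)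
    (fun i => i.elim0) (fun i => i.elim0)
  have h0 : x ∘ (Fin.elim0 : Fin 0 → Fin N) = Fin.elim0 := Subsingleton.elim _ _
  rw [h0, ← List.ofFn_eq_map, List.toFinset_finRange, Finset.univ_eq_empty, Finset.image_empty,
    Finset.empty_union] at h
  rw [sum_finpartition, ← h]
  rfl

end Expectation

end

end QTFock

theorem mainTheorem3 {E : Type*} [NormedAddCommGroup E] [InnerProductSpace ℝ E] [CompleteSpace E]
    [TopologicalSpace.SeparableSpace E] (q t : ℝ) (ht0 : 0 < t) (ht1 : t < 1) (hqt : |q| ≤ t)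
    (T : E → Complexification E →L[ℂ] Complexification E) (hT : ∀ x, IsSelfAdjoint (T x))
    (n : ℕ) (x : Fin n → E) :
    QTFock.vacuumState q t
        (List.ofFn fun i =>
          QTFock.fieldOperator q t (Complexification.ofReal (x i)) (T (x i))).reverse.prod =
      ∑ π : Finpartition (Finset.univ : Finset (Fin n)) with ∀ B ∈ π.parts, 2 ≤ B.card,
        (q : ℂ) ^ QTFock.rc π * (t : ℂ) ^ QTFock.rarc π *
          ∏ B : π.parts,
            QTFock.blockFactor (fun i => Complexification.ofReal (x i)) (fun i => T (x i))
              B.1 (π.nonempty_of_mem_parts B.2) := by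
  exact QTFock.vacuumState_prod_fieldOperator q t _ _
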